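/- Let $k_0$ be a field of characteristic $0$ and let $P = k_0((x))((\partial^{-1}))$ be the skew field of formal pseudo-differential operators $L=\sum_{i\le m} a_i\partial^i$, $a_i\in k_0((x))$, multiplied by the Leibniz rule $(\sum_i a_i\partial^i)(\sum_j b_j\partial^j)=\sum_{i,j;\,l\ge 0}\binom{i}{l}\,a_i\,\frac{d^l b_j}{dx^l}\,\partial^{i+j-l}$. The order $\operatorname{ord}(L)$ of $L\neq 0$ is the largest $i$ with $a_i\ne 0$; $P_-$ is the set of operators of order $<0$ (including $0$); and $\operatorname{res}_P(L)\in k_0$ is the coefficient of $x^{-1}$ in $a_{-1}$. For $L=\partial^k+(\text{terms of order}<k)$ with $k\in\mathbb Z$, $k\neq 0$, let $L^{1/k}$ be the unique operator of the form $\partial+(\text{terms of order}<1)$ whose $k$-th power is $L$, and put $L^{j/k}=(L^{1/k})^j$ for $j\in\mathbb Z$. Theorem 2. Let $L, M\in P$ be operators of nonzero order (positive or negative), each of the form $\partial^m+(\text{terms of order}<m-1)$, where $m\in\mathbb Z$ may a priori be different for $L$ and $M$. Then the following conditions are equivalent: (i) there is $S\in 1+P_-$ such that $M=S^{-1}LS$;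 (ii) $\operatorname{ord}(L)=\operatorname{ord}(M)=:k$, and $\operatorname{res}_P(L^q)=\operatorname{res}_P(M^q)$ for all $q\in\frac1k\mathbb Z$. -/

import Mathlib

/-- The formal pseudo-differential operators `L = ∑_{i ≤ m} a_i ∂ ^ i` with coefficients `a_i` in a
commutative ring `A` with a derivation `d`; `L.coeff i` is `a_i`. The derivation is a parameter of
the type because it determines the product. -/
@[ext]
structure PseudoDiffOp {A : Type*} [CommRing A] (d : Derivation ℤ A A) where
  coeff : ℤ → A
  bdd : ∃ N : ℤ, ∀ n, N ≤ n → coeff n = 0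

namespace PseudoDiffOp

noncomputable section

open Finset

variable {A : Type*} [CommRing A] {d : Derivation ℤ A A}

theorem coeff_injective : Function.Injective (coeff : PseudoDiffOp d → ℤ → A) :=
  fun _ _ h => PseudoDiffOp.ext h

instance : Zero (PseudoDiffOp d) := ⟨⟨0, 0, fun _ _ => rfl⟩⟩

instance : Add (PseudoDiffOp d) := ⟨fun f g => ⟨f.coeff + g.coeff, by
  obtain ⟨N, hN⟩ := f.bdd
  obtain ⟨M, hM⟩ := g.bdd
  exact ⟨max N M, fun n hn => by simp [hN n (by omega), hM n (by omega)]⟩⟩⟩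

instance : Neg (PseudoDiffOp d) := ⟨fun f => ⟨-f.coeff, by
  obtain ⟨N, hN⟩ := f.bdd
  exact ⟨N, fun n hn => by simp [hN n hn]⟩⟩⟩

instance : Sub (PseudoDiffOp d) := ⟨fun f g => ⟨f.coeff - g.coeff, by
  obtain ⟨N, hN⟩ := f.bdd
  obtain ⟨M, hM⟩ := g.bdd
  exact ⟨max N M, fun n hn => by simp [hN n (by omega), hM n (by omega)]⟩⟩⟩

instance : SMul ℕ (PseudoDiffOp d) := ⟨fun c f => ⟨c • f.coeff, by
  obtain ⟨N, hN⟩ := f.bdd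
  exact ⟨N, fun n hn => by simp [hN n hn]⟩⟩⟩

instance : SMul ℤ (PseudoDiffOp d) := ⟨fun c f => ⟨c • f.coeff, by
  obtain ⟨N, hN⟩ := f.bdd
  exact ⟨N, fun n hn => by simp [hN n hn]⟩⟩⟩

/-- Addition is coefficientwise. -/
instance : AddCommGroup (PseudoDiffOp d) :=
  coeff_injective.addCommGroup coeff rfl (fun _ _ => rfl) (fun _ => rfl) (fun _ _ => rfl)
    (fun _ _ => rfl) (fun _ _ => rfl)

@[simp] theorem coeff_zero (n : ℤ) : (0 : PseudoDiffOp d).coeff n = 0 := rfl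
@[simp] theorem coeff_add (f g : PseudoDiffOp d) (n : ℤ) :
    (f + g).coeff n = f.coeff n + g.coeff n := rfl
@[simp] theorem coeff_sub (f g : PseudoDiffOp d) (n : ℤ) :
    (f - g).coeff n = f.coeff n - g.coeff n := rfl
@[simp] theorem coeff_neg (f : PseudoDiffOp d) (n : ℤ) : (-f).coeff n = -f.coeff n := rfl

/-- The operators of order `< m` (including `0`). For `m = 0` this is the subspace `P_-`. -/
def ordLT (d : Derivation ℤ A A) (m : ℤ) : AddSubgroup (PseudoDiffOp d) where
  carrier := {f | ∀ n, m ≤ n → f.coeff n = 0}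
  zero_mem' := fun _ _ => rfl
  add_mem' := fun hf hg n hn => by simp [hf n hn, hg n hn]
  neg_mem' := fun hf n hn => by simp [hf n hn]

theorem mem_ordLT {f : PseudoDiffOp d} {m : ℤ} :
    f ∈ ordLT d m ↔ ∀ n, m ≤ n → f.coeff n = 0 := Iff.rfl

theorem ordLT_mono {m m' : ℤ} (h : m ≤ m') : ordLT d m ≤ ordLT d m' :=
  fun _ hf n hn => hf n (h.trans hn)

theorem exists_mem_ordLT (f : PseudoDiffOp d) : ∃ N, f ∈ ordLT d N := f.bdd

/-- The contribution of `f_i` to the coefficient of `∂ ^ n` in the product of `∑ f_i ∂ ^ i` and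
`∑ g_j ∂ ^ j`, through the term `(i choose k) f_i d^k(g_j) ∂ ^ (i + j - k)` with `i + j - k = n`.
The index is `p = (i, k)`, and `j = n - i + k`. -/
def mulTerm (f g : ℤ → A) (d : Derivation ℤ A A) (n : ℤ) (p : ℤ × ℕ) : A :=
  Ring.choose p.1 p.2 • (f p.1 * d^[p.2] (g (n - p.1 + p.2)))

theorem mulTerm_support {f g : ℤ → A} {N M : ℤ} (hf : ∀ n, N ≤ n → f n = 0)
    (hg : ∀ n, M ≤ n → g n = 0) (n : ℤ) :
    Function.support (mulTerm f g d n) ⊆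
      ((Finset.Ico (n - M) N ×ˢ Finset.range (N + M - n).toNat : Finset (ℤ × ℕ)) :
        Set (ℤ × ℕ)) := by
  rintro ⟨i, k⟩ h
  have h1 : i < N := by
    by_contra hc
    exact h (by simp [mulTerm, hf i (by omega)])
  have h2 : n - i + k < M := by
    by_contra hc
    exact h (by simp [mulTerm, hg (n - i + k) (by omega)])
  simp only [Finset.coe_product, Set.mem_prod, Finset.coe_Ico, Set.mem_Ico, Finset.coe_range,
    Set.mem_Iio]
  exact ⟨⟨by omega, by omega⟩, by omega⟩

theorem mulTerm_finite (f g : PseudoDiffOp d) (n : ℤ) :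
    (Function.support (mulTerm f.coeff g.coeff d n)).Finite := by
  obtain ⟨N, hN⟩ := f.bdd
  obtain ⟨M, hM⟩ := g.bdd
  exact (Finset.finite_toSet _).subset (mulTerm_support hN hM n)

theorem mulTerm_eq_zero {f g : ℤ → A} {N M : ℤ} (hf : ∀ n, N ≤ n → f n = 0)
    (hg : ∀ n, M ≤ n → g n = 0) {n : ℤ} (hn : N + M - 1 ≤ n) (p : ℤ × ℕ) :
    mulTerm f g d n p = 0 := by
  rcases le_or_gt N p.1 with h | h
  · simp [mulTerm, hf p.1 h]
  · simp [mulTerm, hg (n - p.1 + p.2) (by omega)]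

/-- The product given by the Leibniz rule
`(∑ a_i ∂ ^ i) (∑ b_j ∂ ^ j) = ∑_{i, j, k ≥ 0} (i choose k) a_i d^k(b_j) ∂ ^ (i + j - k)`. The sum in
each coefficient has only finitely many nonzero terms. -/
instance : Mul (PseudoDiffOp d) := ⟨fun f g =>
  ⟨fun n => ∑ᶠ p : ℤ × ℕ, mulTerm f.coeff g.coeff d n p, by
    obtain ⟨N, hN⟩ := f.bdd
    obtain ⟨M, hM⟩ := g.bdd
    exact ⟨N + M - 1, fun n hn => by simp [mulTerm_eq_zero hN hM hn]⟩⟩⟩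

theorem coeff_mul (f g : PseudoDiffOp d) (n : ℤ) :
    (f * g).coeff n = ∑ᶠ p : ℤ × ℕ, mulTerm f.coeff g.coeff d n p := rfl

theorem mul_mem_ordLT {f g : PseudoDiffOp d} {a b : ℤ} (hf : f ∈ ordLT d a) (hg : g ∈ ordLT d b) :
    f * g ∈ ordLT d (a + b - 1) := fun n hn => by
  rw [coeff_mul]; simp [mulTerm_eq_zero hf hg hn]

instance : NonUnitalNonAssocRing (PseudoDiffOp d) where
  left_distrib f g h := by
    ext n
    rw [coeff_add, coeff_mul, coeff_mul, coeff_mul,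
      ← finsum_add_distrib (mulTerm_finite f g n) (mulTerm_finite f h n)]
    exact finsum_congr fun p => by simp [mulTerm, mul_add, iterate_map_add]
  right_distrib f g h := by
    ext n
    rw [coeff_add, coeff_mul, coeff_mul, coeff_mul,
      ← finsum_add_distrib (mulTerm_finite f h n) (mulTerm_finite g h n)]
    exact finsum_congr fun p => by simp [mulTerm, add_mul]
  zero_mul f := by
    ext n
    rw [coeff_mul]; simp [mulTerm]
  mul_zero f := by
    ext n
    rw [coeff_mul]; simp [mulTerm, iterate_map_zero]

/-- The operator `a ∂ ^ i`. -/
def mono (d : Derivation ℤ A A) (a : A) (i : ℤ) : PseudoDiffOp d :=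
  ⟨fun n => if n = i then a else 0, i + 1, fun n hn => if_neg (by omega)⟩

theorem coeff_mono (a : A) (i n : ℤ) : (mono d a i).coeff n = if n = i then a else 0 := rfl

theorem mono_mem (a : A) (i : ℤ) : mono d a i ∈ ordLT d (i + 1) :=
  fun n hn => if_neg (by omega)

theorem coeff_mul_mono (f : PseudoDiffOp d) (c : A) (l n : ℤ) {w : ℕ}
    (hf : f ∈ ordLT d (n + w - l + 1)) :
    (f * mono d c l).coeff n =
      ∑ s ∈ range (w + 1), Ring.choose (n + s - l) s • (f.coeff (n + s - l) * d^[s] c) := by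
  rw [coeff_mul, finsum_eq_sum_of_support_subset (s := (range (w + 1)).image
    (fun s : ℕ => (n + s - l, s)))]
  · rw [sum_image (by intro a _ b _ h; exact (Prod.ext_iff.1 h).2)]
    refine sum_congr rfl fun s _ => ?_
    simp only [mulTerm, coeff_mono]
    rw [if_pos (by omega)]
  · rintro ⟨i, k⟩ h
    have h1 : i < n + w - l + 1 := by
      by_contra hc
      exact h (by simp [mulTerm, hf i (by omega)])
    have h2 : n - i + k = l := by
      by_contra hc
      exact h (by simp [mulTerm, coeff_mono, hc])
    simp only [coe_image, Set.mem_image, coe_range, Set.mem_Iio, Prod.mk.injEq]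
    exact ⟨k, by omega, by omega, rfl⟩

theorem coeff_mono_mul (a : A) (i : ℤ) (g : PseudoDiffOp d) (n : ℤ) {w : ℕ}
    (hg : g ∈ ordLT d (n - i + w + 1)) :
    (mono d a i * g).coeff n =
      ∑ k ∈ range (w + 1), Ring.choose i k • (a * d^[k] (g.coeff (n - i + k))) := by
  rw [coeff_mul, finsum_eq_sum_of_support_subset (s := (range (w + 1)).image
    (fun s : ℕ => (i, s)))]
  · rw [sum_image (by intro a _ b _ h; exact (Prod.ext_iff.1 h).2)]
    refine sum_congr rfl fun s _ => ?_
    simp [mulTerm, coeff_mono]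
  · rintro ⟨i', k⟩ h
    have h1 : i' = i := by
      by_contra hc
      exact h (by simp [mulTerm, coeff_mono, hc])
    have h2 : n - i' + k < n - i + w + 1 := by
      by_contra hc
      exact h (by simp [mulTerm, hg (n - i' + k) (by omega)])
    simp only [coe_image, Set.mem_image, coe_range, Set.mem_Iio, Prod.mk.injEq]
    exact ⟨k, by omega, by omega, rfl⟩

theorem coeff_mono_mul_mono (a b : A) (i j n : ℤ) {w : ℕ} (hw : n + w = i + j) :
    (mono d a i * mono d b j).coeff n = Ring.choose i w • (a * d^[w] b) := by
  rw [coeff_mono_mul _ _ _ _ (w := w) (ordLT_mono (by omega) (mono_mem b j)),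
    sum_eq_single w]
  · rw [coeff_mono, if_pos (by omega)]
  · intro k _ hk
    rw [coeff_mono, if_neg (by omega)]
    simp [iterate_map_zero]
  · simp

theorem iterate_leibniz (k : ℕ) (a b : A) :
    d^[k] (a * b) = ∑ p ∈ antidiagonal k, k.choose p.1 • (d^[p.1] a * d^[p.2] b) := by
  induction k with
  | zero => simp
  | succ k ih =>
    rw [Function.iterate_succ_apply', ih, map_sum]
    simp only [map_nsmul, Derivation.leibniz, ← Function.iterate_succ_apply' d, smul_eq_mul]
    have := Finset.sum_antidiagonal_choose_succ_nsmul (M := A)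
      (fun i j => d^[i] a * d^[j] b) k
    rw [this, ← sum_add_distrib]
    refine sum_congr rfl fun p hp => ?_
    have hp' : p.1 + p.2 = k := HasAntidiagonal.mem_antidiagonal.1 hp
    rw [mul_comm (d^[p.2] b), smul_add, Nat.choose_symm_of_eq_add hp'.symm]

theorem choose_comb (i j : ℤ) (t u : ℕ) :
    ∑ p ∈ antidiagonal u, ((t + p.1).choose t : ℤ) * Ring.choose i (t + p.1) * Ring.choose j p.2
      = Ring.choose i t * Ring.choose (i + j - t) u := by
  have h := Ring.add_choose_eq (R := ℤ) (r := i - t) (s := j) u (Commute.all _ _)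
  rw [show i + j - t = i - t + j by ring, h, mul_sum]
  refine sum_congr rfl fun p _ => ?_
  have := Ring.choose_smul_choose (R := ℤ) i (n := t + p.1) (k := t) (by omega)
  rw [Nat.add_sub_cancel_left, nsmul_eq_mul] at this
  rw [this]; ring

theorem mono_assoc (a b c : A) (i j l : ℤ) :
    mono d a i * mono d b j * mono d c l = mono d a i * (mono d b j * mono d c l) := by
  ext n
  by_cases hw : i + j + l < n
  · have h1 := mul_mem_ordLT (mul_mem_ordLT (mono_mem (d := d) a i) (mono_mem b j)) (mono_mem c l)
    have h2 := mul_mem_ordLT (mono_mem (d := d) a i) (mul_mem_ordLT (mono_mem b j) (mono_mem c l))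
    rw [h1 n (by omega), h2 n (by omega)]
  obtain ⟨w, hw⟩ : ∃ w : ℕ, n + w = i + j + l := ⟨(i + j + l - n).toNat, by omega⟩
  rw [coeff_mul_mono _ _ _ _ (w := w)
      (ordLT_mono (by omega) (mul_mem_ordLT (mono_mem a i) (mono_mem b j))),
    coeff_mono_mul _ _ _ _ (w := w)
      (ordLT_mono (by omega) (mul_mem_ordLT (mono_mem b j) (mono_mem c l)))]
  rw [← Nat.sum_antidiagonal_eq_sum_range_succ_mk
      (fun p => Ring.choose (n + p.1 - l) p.1 •
        ((mono d a i * mono d b j).coeff (n + p.1 - l) * d^[p.1] c)),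
    ← Nat.sum_antidiagonal_eq_sum_range_succ_mk
      (fun p => Ring.choose i p.1 •
        (a * d^[p.1] ((mono d b j * mono d c l).coeff (n - i + p.1))))]
  have hL : ∀ p ∈ antidiagonal w, Ring.choose (n + p.1 - l) p.1 •
        ((mono d a i * mono d b j).coeff (n + p.1 - l) * d^[p.1] c) =
      (Ring.choose i p.2 * Ring.choose (i + j - p.2) p.1) • (a * (d^[p.2] b * d^[p.1] c)) := by
    intro p hp
    rw [HasAntidiagonal.mem_antidiagonal] at hp
    rw [coeff_mono_mul_mono _ _ _ _ _ (w := p.2) (by omega),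
      show n + p.1 - l = i + j - p.2 by omega, smul_mul_assoc, smul_smul, mul_comm, mul_assoc]
  have hR : ∀ p ∈ antidiagonal w, Ring.choose i p.1 •
        (a * d^[p.1] ((mono d b j * mono d c l).coeff (n - i + p.1))) =
      ∑ q ∈ antidiagonal p.1, ((q.1 + q.2).choose q.1 * Ring.choose i (q.1 + q.2) *
        Ring.choose j p.2) • (a * (d^[q.1] b * d^[q.2 + p.2] c)) := by
    intro p hp
    rw [HasAntidiagonal.mem_antidiagonal] at hp
    rw [coeff_mono_mul_mono _ _ _ _ _ (w := p.2) (by omega), iterate_map_zsmul, iterate_leibniz,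
      mul_smul_comm, mul_sum, smul_sum, smul_sum]
    refine sum_congr rfl fun q hq => ?_
    rw [HasAntidiagonal.mem_antidiagonal] at hq
    rw [hq, Function.iterate_add_apply, mul_smul_comm, ← natCast_zsmul, smul_smul, smul_smul]
    congr 1
    ring
  have hL' : ∀ p ∈ antidiagonal w,
      (Ring.choose i p.2 * Ring.choose (i + j - p.2) p.1) • (a * (d^[p.2] b * d^[p.1] c)) =
      ∑ q ∈ antidiagonal p.1, ((p.2 + q.1).choose p.2 * Ring.choose i (p.2 + q.1) *
        Ring.choose j q.2) • (a * (d^[p.2] b * d^[q.1 + q.2] c)) := by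
    intro p _
    rw [← choose_comb, sum_smul]
    refine sum_congr rfl fun q hq => ?_
    rw [HasAntidiagonal.mem_antidiagonal] at hq
    rw [hq]
  rw [sum_congr rfl hL, sum_congr rfl hR, sum_congr rfl hL', sum_sigma', sum_sigma']
  refine sum_nbij' (fun x => ⟨(x.1.2 + x.2.1, x.2.2), (x.1.2, x.2.1)⟩)
    (fun x => ⟨(x.2.2 + x.1.2, x.2.1), (x.2.2, x.1.2)⟩) ?_ ?_ ?_ ?_ ?_
  · rintro ⟨⟨x1, x2⟩, ⟨y1, y2⟩⟩ h
    simp only [mem_sigma, HasAntidiagonal.mem_antidiagonal] at h ⊢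
    exact ⟨by omega, trivial⟩
  · rintro ⟨⟨x1, x2⟩, ⟨y1, y2⟩⟩ h
    simp only [mem_sigma, HasAntidiagonal.mem_antidiagonal] at h ⊢
    exact ⟨by omega, trivial⟩
  · rintro ⟨⟨x1, x2⟩, ⟨y1, y2⟩⟩ h
    simp only [mem_sigma, HasAntidiagonal.mem_antidiagonal] at h ⊢
    obtain ⟨h1, rfl⟩ := h
    rfl
  · rintro ⟨⟨x1, x2⟩, ⟨y1, y2⟩⟩ h
    simp only [mem_sigma, HasAntidiagonal.mem_antidiagonal] at h ⊢
    obtain ⟨h1, rfl⟩ := h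
    rfl
  · rintro ⟨⟨x1, x2⟩, ⟨y1, y2⟩⟩ h
    rfl

theorem exists_trunc (f : PseudoDiffOp d) (m : ℤ) :
    ∃ f' ∈ AddSubgroup.closure (Set.range fun p : A × ℤ => mono d p.1 p.2),
      f - f' ∈ ordLT d m := by
  obtain ⟨N, hN⟩ := f.bdd
  refine ⟨∑ i ∈ Finset.Ico m N, mono d (f.coeff i) i,
    sum_mem fun i _ => AddSubgroup.subset_closure ⟨(f.coeff i, i), rfl⟩, fun n hn => ?_⟩
  have : (∑ i ∈ Finset.Ico m N, mono d (f.coeff i) i).coeff n =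
      ∑ i ∈ Finset.Ico m N, (mono d (f.coeff i) i).coeff n :=
    map_sum (⟨⟨fun g => g.coeff n, rfl⟩, fun _ _ => rfl⟩ : PseudoDiffOp d →+ A) _ _
  rw [coeff_sub, this]
  simp only [coeff_mono, Finset.sum_ite_eq, Finset.mem_Ico]
  split_ifs with h
  · simp
  · rw [hN n (by omega), sub_zero]

theorem mul_assoc_of_closure {f g h : PseudoDiffOp d}
    (hf : f ∈ AddSubgroup.closure (Set.range fun p : A × ℤ => mono d p.1 p.2))
    (hg : g ∈ AddSubgroup.closure (Set.range fun p : A × ℤ => mono d p.1 p.2))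
    (hh : h ∈ AddSubgroup.closure (Set.range fun p : A × ℤ => mono d p.1 p.2)) :
    f * g * h = f * (g * h) := by
  induction hf using AddSubgroup.closure_induction with
  | zero => simp
  | add x y _ _ hx hy => simp [add_mul, hx, hy]
  | neg x _ hx => simp [hx]
  | mem x hx =>
    obtain ⟨⟨a, i⟩, rfl⟩ := hx
    induction hg using AddSubgroup.closure_induction with
    | zero => simp
    | add x y _ _ hx hy => simp [add_mul, mul_add, hx, hy]
    | neg x _ hx => simp [hx]
    | mem x hx =>
      obtain ⟨⟨b, j⟩, rfl⟩ := hx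
      induction hh using AddSubgroup.closure_induction with
      | zero => simp
      | add x y _ _ hx hy => simp [mul_add, hx, hy]
      | neg x _ hx => simp [hx]
      | mem x hx =>
        obtain ⟨⟨c, l⟩, rfl⟩ := hx
        exact mono_assoc a b c i j l

protected theorem mul_assoc (f g h : PseudoDiffOp d) : f * g * h = f * (g * h) := by
  ext n
  obtain ⟨a, ha⟩ := f.bdd
  obtain ⟨b, hb⟩ := g.bdd
  obtain ⟨c, hc⟩ := h.bdd
  obtain ⟨f', hf', hf⟩ := exists_trunc f (min a (n + 2 - b - c))
  obtain ⟨g', hg', hg⟩ := exists_trunc g (min b (n + 2 - a - c))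
  obtain ⟨h', hh', hh⟩ := exists_trunc h (min c (n + 2 - a - b))
  have ha' : f' ∈ ordLT d a := by
    simpa using (ordLT d a).sub_mem ha (ordLT_mono (min_le_left _ _) hf)
  have hb' : g' ∈ ordLT d b := by
    simpa using (ordLT d b).sub_mem hb (ordLT_mono (min_le_left _ _) hg)
  have e1 : f * g * h = f' * g' * h' +
      ((f - f') * g * h + f' * (g - g') * h + f' * g' * (h - h')) := by
    simp only [sub_mul, mul_sub]; abel
  have e2 : f * (g * h) = f' * (g' * h') +
      ((f - f') * (g * h) + f' * ((g - g') * h) + f' * (g' * (h - h'))) := by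
    simp only [sub_mul, mul_sub]; abel
  have z1 := mul_mem_ordLT (mul_mem_ordLT hf hb) hc n (by omega)
  have z2 := mul_mem_ordLT (mul_mem_ordLT ha' hg) hc n (by omega)
  have z3 := mul_mem_ordLT (mul_mem_ordLT ha' hb') hh n (by omega)
  have y1 := mul_mem_ordLT hf (mul_mem_ordLT hb hc) n (by omega)
  have y2 := mul_mem_ordLT ha' (mul_mem_ordLT hg hc) n (by omega)
  have y3 := mul_mem_ordLT ha' (mul_mem_ordLT hb' hh) n (by omega)
  rw [e1, e2, mul_assoc_of_closure hf' hg' hh']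
  simp only [coeff_add, z1, z2, z3, y1, y2, y3]

instance : One (PseudoDiffOp d) := ⟨mono d 1 0⟩

theorem one_def : (1 : PseudoDiffOp d) = mono d 1 0 := rfl

instance : Ring (PseudoDiffOp d) where
  mul_assoc := PseudoDiffOp.mul_assoc
  one_mul f := by
    ext n
    obtain ⟨N, hN⟩ := f.bdd
    rw [one_def, coeff_mono_mul _ _ _ _ (w := (N - n).toNat) (ordLT_mono (by omega) hN),
      sum_eq_single 0]
    · simp
    · intro k _ hk
      obtain ⟨k, rfl⟩ := Nat.exists_eq_succ_of_ne_zero hk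
      rw [Ring.choose_zero_succ, zero_smul]
    · simp
  mul_one f := by
    ext n
    obtain ⟨N, hN⟩ := f.bdd
    have h1 : ∀ k : ℕ, d^[k + 1] (1 : A) = 0 := fun k => by
      rw [Function.iterate_succ_apply, Derivation.map_one_eq_zero, iterate_map_zero]
    rw [one_def, coeff_mul_mono _ _ _ _ (w := (N - n).toNat) (ordLT_mono (by omega) hN),
      sum_eq_single 0]
    · simp
    · intro k _ hk
      obtain ⟨k, rfl⟩ := Nat.exists_eq_succ_of_ne_zero hk
      rw [h1, mul_zero, smul_zero]
    · simp
  neg_add_cancel := neg_add_cancel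
  zsmul := (· • ·)
  zsmul_zero' := SubNegMonoid.zsmul_zero'
  zsmul_succ' := SubNegMonoid.zsmul_succ'
  zsmul_neg' := SubNegMonoid.zsmul_neg'
  sub_eq_add_neg := sub_eq_add_neg

theorem coeff_mul_top {f g : PseudoDiffOp d} {a b : ℤ} (hf : f ∈ ordLT d (a + 1))
    (hg : g ∈ ordLT d (b + 1)) : (f * g).coeff (a + b) = f.coeff a * g.coeff b := by
  have e : f * g = mono d (f.coeff a) a * g + (f - mono d (f.coeff a) a) * g := by
    rw [sub_mul]; abel
  have h1 : f - mono d (f.coeff a) a ∈ ordLT d a := fun n hn => by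
    rcases hn.eq_or_lt with rfl | h
    · simp [coeff_mono]
    · rw [coeff_sub, hf n (by omega), coeff_mono, if_neg (by omega), sub_zero]
  rw [e, coeff_add, mul_mem_ordLT h1 hg _ (by omega),
    coeff_mono_mul _ _ _ _ (w := 0) (ordLT_mono (by omega) hg)]
  simp

theorem one_mem_ordLT : (1 : PseudoDiffOp d) ∈ ordLT d 1 := mono_mem 1 0

theorem pow_mem_ordLT {f : PseudoDiffOp d} (hf : f ∈ ordLT d 0) (p : ℕ) :
    f ^ p ∈ ordLT d (1 - p) := by
  induction p with
  | zero => simpa using one_mem_ordLT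
  | succ p ih =>
    rw [pow_succ]
    exact ordLT_mono (by push_cast; omega) (mul_mem_ordLT ih hf)

theorem exists_limit (F : ℕ → PseudoDiffOp d) (hF : ∀ j : ℕ, F (j + 1) - F j ∈ ordLT d (1 - j)) :
    ∃ G, ∀ j : ℕ, G - F j ∈ ordLT d (1 - j) := by
  have key : ∀ P Q : ℕ, P ≤ Q → F Q - F P ∈ ordLT d (1 - P) := by
    intro P Q h
    induction Q, h using Nat.le_induction with
    | base => simp
    | succ Q h ih =>
      rw [← sub_add_sub_cancel (F (Q + 1)) (F Q)]
      exact add_mem (ordLT_mono (by omega) (hF Q)) ih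
  obtain ⟨N, hN⟩ := (F 0).bdd
  refine ⟨⟨fun n => (F (1 - n).toNat).coeff n, max N 1, fun n hn => ?_⟩, fun P n hn => ?_⟩
  · rw [show (1 - n).toNat = 0 by omega]
    exact hN n (by omega)
  · have h := key (1 - n).toNat P (by omega) n (by omega)
    rw [coeff_sub, sub_eq_zero] at h ⊢
    exact h.symm

theorem eq_zero_of_forall_mem {f : PseudoDiffOp d} {c : ℤ} (h : ∀ j : ℕ, f ∈ ordLT d (c - j)) :
    f = 0 := by
  ext n
  exact h (c - n).toNat n (by omega)

theorem exists_right_inv {N : PseudoDiffOp d} (hN : N ∈ ordLT d 0) :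
    ∃ G, (1 - N) * G = 1 := by
  obtain ⟨G, hG⟩ := exists_limit (fun j => ∑ p ∈ range j, N ^ p) fun j => by
    simpa only [sum_range_succ, add_sub_cancel_left] using pow_mem_ordLT hN j
  refine ⟨G, sub_eq_zero.1 (eq_zero_of_forall_mem (c := 1) fun P => ?_)⟩
  have e : (1 - N) * G - 1 = (1 - N) * (G - ∑ p ∈ range P, N ^ p) - N ^ P := by
    rw [mul_sub, mul_neg_geom_sum]; abel
  rw [e]
  refine sub_mem (ordLT_mono (by omega) (mul_mem_ordLT (sub_mem one_mem_ordLT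
    (ordLT_mono (by norm_num) hN)) (hG P))) (pow_mem_ordLT hN P)

section Order

/-- The order of `L = ∑ a_i ∂ ^ i`: the largest `m` with `a_m ≠ 0` (and `0` for `L = 0`). -/
def ord (L : PseudoDiffOp d) : ℤ := sSup {n | L.coeff n ≠ 0}

theorem bddAbove_support (L : PseudoDiffOp d) : BddAbove {n | L.coeff n ≠ 0} := by
  obtain ⟨N, hN⟩ := L.bdd
  exact ⟨N, fun n hn => le_of_not_ge fun h => hn (hN n h)⟩

theorem coeff_ord_ne_zero {L : PseudoDiffOp d} (hL : L ≠ 0) : L.coeff L.ord ≠ 0 := by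
  have hne : {n | L.coeff n ≠ 0}.Nonempty := by
    by_contra h
    exact hL (PseudoDiffOp.ext (funext fun n => by
      by_contra hn
      exact h ⟨n, hn⟩))
  exact Int.csSup_mem hne L.bddAbove_support

theorem mem_ordLT_ord (L : PseudoDiffOp d) : L ∈ ordLT d (L.ord + 1) := fun n hn => by
  by_contra h
  have := le_csSup L.bddAbove_support (show n ∈ {n | L.coeff n ≠ 0} from h)
  change n ≤ L.ord at this
  omega

end Order

section DivisionRing

variable {K : Type*} [Field K] {δ : Derivation ℤ K K}

instance : Nontrivial (PseudoDiffOp δ) :=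
  ⟨⟨1, 0, fun h => by simpa [one_def, coeff_mono] using congrArg (fun f => f.coeff 0) h⟩⟩

theorem exists_mul_eq_one {L : PseudoDiffOp δ} (hL : L ≠ 0) : ∃ X, L * X = 1 := by
  have hT : L * mono δ 1 (-L.ord) * mono δ (L.coeff L.ord)⁻¹ 0 - 1 ∈ ordLT δ 0 := by
    have m1 := mul_mem_ordLT L.mem_ordLT_ord (mono_mem (d := δ) 1 (-L.ord))
    have m2 := mul_mem_ordLT m1 (mono_mem (d := δ) (L.coeff L.ord)⁻¹ 0)
    intro n hn
    rcases hn.eq_or_lt with rfl | h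
    · have t1 := coeff_mul_top L.mem_ordLT_ord (mono_mem (d := δ) 1 (-L.ord))
      have t2 := coeff_mul_top (a := 0) (b := 0) (ordLT_mono (by omega) m1)
        (mono_mem (d := δ) (L.coeff L.ord)⁻¹ 0)
      rw [add_neg_cancel] at t1
      rw [coeff_sub]
      rw [add_zero] at t2
      rw [t2, t1]
      simp [coeff_mono, one_def, coeff_ord_ne_zero hL]
    · rw [coeff_sub, m2 n (by omega), one_def, coeff_mono, if_neg (by omega), sub_zero]
  obtain ⟨G, hG⟩ := exists_right_inv (neg_mem hT)
  refine ⟨mono δ 1 (-L.ord) * mono δ (L.coeff L.ord)⁻¹ 0 * G, ?_⟩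
  rw [← hG]
  simp [mul_assoc]

open Classical in
instance : Inv (PseudoDiffOp δ) := ⟨fun L => if h : L = 0 then 0 else (exists_mul_eq_one h).choose⟩

theorem inv_of_ne {L : PseudoDiffOp δ} (h : L ≠ 0) : L⁻¹ = (exists_mul_eq_one h).choose :=
  dif_neg h

instance : DivisionRing (PseudoDiffOp δ) where
  inv_zero := dif_pos rfl
  mul_inv_cancel L hL := by
    rw [inv_of_ne hL]
    exact (exists_mul_eq_one hL).choose_spec
  nnqsmul := _
  nnqsmul_def := fun _ _ => rfl
  qsmul := _
  qsmul_def := fun _ _ => rfl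

/-- The operator `∂`. -/
def D (δ : Derivation ℤ K K) : PseudoDiffOp δ := mono δ 1 1

theorem ord_eq {L : PseudoDiffOp δ} {m : ℤ} (h : L ∈ ordLT δ (m + 1)) (h0 : L.coeff m ≠ 0) :
    L.ord = m := by
  have h1 := coeff_ord_ne_zero (L := L) (by rintro rfl; exact h0 rfl)
  refine le_antisymm ?_ ?_
  · by_contra hc
    exact h1 (h _ (by omega))
  · by_contra hc
    exact h0 (L.mem_ordLT_ord _ (by omega))

/-- `L = ∂ ^ m + (terms of order < m)`. -/
def IsMonic (L : PseudoDiffOp δ) (m : ℤ) : Prop := L ∈ ordLT δ (m + 1) ∧ L.coeff m = 1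

theorem IsMonic.ord_eq {L : PseudoDiffOp δ} {m : ℤ} (h : IsMonic L m) : L.ord = m :=
  PseudoDiffOp.ord_eq h.1 (by rw [h.2]; exact one_ne_zero)

theorem IsMonic.mul {L M : PseudoDiffOp δ} {a b : ℤ} (hL : IsMonic L a) (hM : IsMonic M b) :
    IsMonic (L * M) (a + b) :=
  ⟨ordLT_mono (by omega) (mul_mem_ordLT hL.1 hM.1), by
    rw [coeff_mul_top hL.1 hM.1, hL.2, hM.2, one_mul]⟩

theorem isMonic_one : IsMonic (1 : PseudoDiffOp δ) 0 := ⟨one_mem_ordLT, rfl⟩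

theorem isMonic_D : IsMonic (D δ) 1 := ⟨mono_mem 1 1, rfl⟩

theorem IsMonic.pow {L : PseudoDiffOp δ} (hL : IsMonic L 1) (n : ℕ) : IsMonic (L ^ n) n := by
  induction n with
  | zero => exact isMonic_one
  | succ n ih =>
    rw [pow_succ]
    exact_mod_cast ih.mul hL

theorem IsMonic.inv {L : PseudoDiffOp δ} {m : ℤ} (hL : IsMonic L m) : IsMonic L⁻¹ (-m) := by
  have h0 : L ≠ 0 := by
    rintro rfl
    exact zero_ne_one hL.2
  have h1 := coeff_mul_top hL.1 L⁻¹.mem_ordLT_ord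
  have h2 := coeff_ord_ne_zero (inv_ne_zero h0)
  rw [mul_inv_cancel₀ h0, hL.2, one_mul, one_def, coeff_mono] at h1
  split_ifs at h1 with h
  · have h3 : L⁻¹.ord = -m := by omega
    exact ⟨h3 ▸ L⁻¹.mem_ordLT_ord, by rw [← h3, h1]⟩
  · exact absurd h1.symm h2

theorem IsMonic.add {R E : PseudoDiffOp δ} {m : ℤ} (hR : IsMonic R 1) (hm : m ≤ 0)
    (hE : E ∈ ordLT δ (m + 1)) : IsMonic (R + E) 1 :=
  ⟨add_mem hR.1 (ordLT_mono (by omega) hE), by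
    rw [coeff_add, hR.2, hE 1 (by omega), add_zero]⟩

theorem add_pow_sub_pow {R E : PseudoDiffOp δ} {m : ℤ} (hR : IsMonic R 1) (hm : m ≤ 0)
    (hE : E ∈ ordLT δ (m + 1)) (n : ℕ) :
    (R + E) ^ n - R ^ n ∈ ordLT δ (m + n) ∧
      ((R + E) ^ n - R ^ n).coeff (m + n - 1) = n * E.coeff m := by
  induction n with
  | zero => simp
  | succ n ih =>
    have e : (R + E) ^ (n + 1) - R ^ (n + 1) =
        (R + E) ^ n * E + ((R + E) ^ n - R ^ n) * R := by
      rw [pow_succ, pow_succ, mul_add, sub_mul]; abel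
    have hn := (hR.add hm hE).pow n
    have ih1 : (R + E) ^ n - R ^ n ∈ ordLT δ (m + n - 1 + 1) := by simpa using ih.1
    rw [e]
    refine ⟨add_mem (ordLT_mono (by push_cast; omega) (mul_mem_ordLT hn.1 hE))
      (ordLT_mono (by push_cast; omega) (mul_mem_ordLT ih.1 hR.1)), ?_⟩
    have t1 := coeff_mul_top hn.1 hE
    have t2 := coeff_mul_top ih1 hR.1
    rw [show m + ((n + 1 : ℕ) : ℤ) - 1 = n + m by push_cast; ring, coeff_add, t1,
      show (n : ℤ) + m = m + n - 1 + 1 by ring, t2, hn.2, hR.2, ih.2]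
    push_cast
    ring

theorem exists_pow_eq [CharZero K] {L : PseudoDiffOp δ} {n : ℕ} (hn : n ≠ 0) (hL : IsMonic L n) :
    ∃ R, IsMonic R 1 ∧ R ^ n = L := by
  let F : ℕ → PseudoDiffOp δ := fun j => Nat.rec (D δ)
    (fun j R => R + mono δ ((L - R ^ n).coeff (n - 1 - j) / n) (-j)) j
  have hF : ∀ j, F (j + 1) = F j + mono δ ((L - F j ^ n).coeff (n - 1 - j) / n) (-j) :=
    fun _ => rfl
  have key : ∀ j, IsMonic (F j) 1 ∧ L - F j ^ n ∈ ordLT δ (n - j) := by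
    intro j
    induction j with
    | zero =>
      refine ⟨isMonic_D, fun i hi => ?_⟩
      have h := (isMonic_D (δ := δ)).pow n
      change (L - D δ ^ n).coeff i = 0
      rcases eq_or_ne i n with rfl | hne
      · rw [coeff_sub, hL.2, h.2, sub_self]
      · rw [coeff_sub, hL.1 i (by push_cast at hi; omega), h.1 i (by push_cast at hi; omega),
          sub_self]
    | succ j ih =>
      have hE := mono_mem (d := δ) ((L - F j ^ n).coeff (n - 1 - j) / n) (-j)
      obtain ⟨h1, h2⟩ := add_pow_sub_pow ih.1 (by omega) hE n
      rw [hF]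
      refine ⟨ih.1.add (by omega) hE, fun i hi => ?_⟩
      rw [← sub_sub_sub_cancel_right _ _ (F j ^ n), coeff_sub]
      rcases eq_or_ne i (n - 1 - j) with rfl | hne
      · rw [show (n : ℤ) - 1 - j = -j + n - 1 by ring] at h2 ⊢
        rw [h2, coeff_mono, if_pos rfl]
        field_simp
        ring
      · rw [ih.2 i (by push_cast at hi; omega), h1 i (by push_cast at hi; omega), sub_zero]
  obtain ⟨R, hR⟩ := exists_limit F fun j => by
    rw [hF, add_sub_cancel_left]
    exact ordLT_mono (by omega) (mono_mem _ _)
  have hR' : ∀ j, F j + (R - F j) = R := fun j => by abel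
  have hRm : ∀ j : ℕ, R - F j ∈ ordLT δ (-j + 1) := fun j => ordLT_mono (by omega) (hR j)
  refine ⟨R, ?_, ?_⟩
  · have := (key 0).1.add (m := 0) le_rfl (by simpa using hRm 0)
    rwa [hR'] at this
  · refine (sub_eq_zero.1 (eq_zero_of_forall_mem (c := n) fun j => ?_)).symm
    have := (add_pow_sub_pow (key j).1 (by omega) (hRm j) n).1
    rw [hR'] at this
    rw [← sub_sub_sub_cancel_right _ _ (F j ^ n)]
    exact sub_mem (key j).2 (ordLT_mono (by omega) this)

theorem pow_inj [CharZero K] {R R' : PseudoDiffOp δ} {n : ℕ} (hn : n ≠ 0) (hR : IsMonic R 1)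
    (hR' : IsMonic R' 1) (h : R' ^ n = R ^ n) : R' = R := by
  by_contra hne
  have h0 : R' - R ≠ 0 := sub_ne_zero.2 hne
  have hm : (R' - R).ord ≤ 0 := by
    by_contra hc
    apply coeff_ord_ne_zero h0
    rcases eq_or_ne (R' - R).ord 1 with h1 | h1
    · rw [h1, coeff_sub, hR.2, hR'.2, sub_self]
    · rw [coeff_sub, hR.1 _ (by omega), hR'.1 _ (by omega), sub_self]
  have := (add_pow_sub_pow hR hm (R' - R).mem_ordLT_ord n).2
  rw [add_sub_cancel, h, sub_self, coeff_zero] at this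
  exact mul_ne_zero (Nat.cast_ne_zero.2 hn) (coeff_ord_ne_zero h0) this.symm

/-- An operator `∂ ^ m + (terms of order < m)` with `m ≠ 0` has exactly one `m`-th root of the form
`∂ + (terms of order < 1)`. -/
theorem existsUnique_root [CharZero K] {L : PseudoDiffOp δ} {m : ℤ} (hm : m ≠ 0)
    (hL : IsMonic L m) : ∃! R, IsMonic R 1 ∧ R ^ L.ord = L := by
  rw [hL.ord_eq]
  obtain ⟨n, rfl | rfl⟩ := m.eq_nat_or_neg
  · have hn : n ≠ 0 := by omega
    obtain ⟨R, h1, h2⟩ := exists_pow_eq hn hL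
    refine ⟨R, ⟨h1, by rwa [zpow_natCast]⟩, fun R' h => pow_inj hn h1 h.1 ?_⟩
    rw [h2, ← zpow_natCast, h.2]
  · have hn : n ≠ 0 := by omega
    obtain ⟨R, h1, h2⟩ := exists_pow_eq hn (by simpa using hL.inv)
    refine ⟨R, ⟨h1, by rw [zpow_neg, zpow_natCast, h2, inv_inv]⟩,
      fun R' h => pow_inj hn h1 h.1 ?_⟩
    rw [h2, ← zpow_natCast, ← inv_inj, ← zpow_neg, h.2, inv_inv]

open Classical in
/-- For `L = ∂ ^ k + (terms of order < k)` with `k ≠ 0`, the operator `L ^ (1 / k)`: the unique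
operator `R = ∂ + (terms of order < 1)` with `R ^ k = L`. -/
def root (L : PseudoDiffOp δ) : PseudoDiffOp δ :=
  if h : ∃ R, IsMonic R 1 ∧ R ^ L.ord = L then h.choose else 1

theorem root_spec [CharZero K] {L : PseudoDiffOp δ} {m : ℤ} (hm : m ≠ 0) (hL : IsMonic L m) :
    IsMonic L.root 1 ∧ L.root ^ L.ord = L := by
  have h := (existsUnique_root hm hL).exists
  rw [root, dif_pos h]
  exact h.choose_spec

/-- For `L = ∂ ^ k + (terms of order < k)` with `k ≠ 0` and `q = j / k` with an integer `j`, the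
operator `L ^ q = (L ^ (1 / k)) ^ j`. (If `q * k` is not an integer, the value has no meaning.) -/
def ratPow (L : PseudoDiffOp δ) (q : ℚ) : PseudoDiffOp δ := L.root ^ (q * L.ord).num

end DivisionRing

end

end PseudoDiffOp

noncomputable section

open scoped LaurentSeries

theorem LaurentSeries.derivative_leibniz {k : Type*} [Field k] (f g : k⸨X⸩) :
    LaurentSeries.derivative k (f * g) =
      f * LaurentSeries.derivative k g + LaurentSeries.derivative k f * g := by
  set θ : k⸨X⸩ → k⸨X⸩ := fun f => HahnSeries.ofSuppBddBelow (fun n => (n : k) * f.coeff n)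
    ⟨f.order, fun x h => by
      contrapose! h
      rw [Function.notMem_support, HahnSeries.coeff_eq_zero_of_lt_order h, mul_zero]⟩ with hθ
  have hc : ∀ f n, (θ f).coeff n = (n : k) * f.coeff n := fun _ _ => rfl
  have hd : ∀ f, LaurentSeries.derivative k f = HahnSeries.single (-1) 1 * θ f := by
    intro f
    ext n
    have := HahnSeries.coeff_single_mul_add (r := (1 : k)) (x := θ f) (a := n + 1) (b := -1)
    rw [add_neg_cancel_right] at this
    rw [this, hc]
    simp
  have hl : θ (f * g) = f * θ g + θ f * g := by
    ext n
    rw [hc, HahnSeries.coeff_add, HahnSeries.coeff_mul, 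
      HahnSeries.coeff_mul_right' (s := g.support) g.isPWO_support (fun n hn h => hn (by simp_all)),
      HahnSeries.coeff_mul_left' (s := f.support) f.isPWO_support (fun n hn h => hn (by simp_all)),
      Finset.mul_sum, ← Finset.sum_add_distrib]
    refine Finset.sum_congr rfl fun p hp => ?_
    have := (Finset.mem_antidiagonal.1 hp).2.2
    rw [hc, hc, ← this]
    push_cast
    ring
  rw [hd, hd, hd, hl]
  ring

/-- An additive map satisfying the Leibniz rule, as a derivation over `ℤ`. -/
def Derivation.ofLeibniz {A : Type*} [CommRing A] (f : A →+ A)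
    (h : ∀ a b, f (a * b) = a * f b + f a * b) : Derivation ℤ A A :=
  Derivation.mk' f.toIntLinearMap fun a b => by
    change f (a * b) = a * f b + b * f a
    rw [h, mul_comm b]

/-- The derivation `d / dx` of the field `k((x))`. -/
def LaurentSeries.ddx (k : Type*) [Field k] :=
  Derivation.ofLeibniz (A := k⸨X⸩) (LaurentSeries.derivative k).toAddMonoidHom
    LaurentSeries.derivative_leibniz

/-- The skew field `P = k((x))((∂⁻¹))` in one variable. -/
abbrev LaurentPDO (k : Type*) [Field k] : Type _ := PseudoDiffOp (LaurentSeries.ddx k)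

namespace LaurentPDO

/-- The operator `∂`. -/
abbrev D (k : Type*) [Field k] : LaurentPDO k := PseudoDiffOp.D (LaurentSeries.ddx k)

/-- The operators of order `< m`. -/
abbrev ordLT (k : Type*) [Field k] (m : ℤ) : AddSubgroup (LaurentPDO k) :=
  PseudoDiffOp.ordLT (LaurentSeries.ddx k) m

/-- The residue `res_P L`: the coefficient of `x⁻¹ ∂⁻¹` in `L`. -/
def res {k : Type*} [Field k] (L : LaurentPDO k) : k := (L.coeff (-1)).coeff (-1)

end LaurentPDO

end

/-! The residue is a trace: `res_mul_comm` gives `res (A * B) = res (B * A)`, so residues are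
invariant under conjugation. Conjugation by a monic operator of order 0 also preserves the order and
commutes with taking roots (`root_conj`), so (i) implies (ii).

Conversely, pass to the roots `R` of `L` and `T` of `M`. Since neither `L` nor `M` has a term just
below the leading one, `R - T` has negative order (`sub_mem_ordLT_zero_of_zpow`). A conjugator of
`R` into `T` is an infinite product of factors `1 + g ∂ ^ (-n)`, `n = 1, 2, ...`. Suppose the
factors so far turn `R` into `R'` with `R' - T = c ∂ ^ (-n) + ...`. The coefficient of `∂⁻¹` in `R'
^ n - T ^ n` is `n c` (`add_pow_sub_pow`), so equality of the residues of the `n`-th powers says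
that `c` has no `x⁻¹` term, that is, `c` is a derivative (`exists_ddx_eq`). Since `[R', g ∂ ^ (-n)]
= g' ∂ ^ (-n) + ...` (`commutator_mono`), choosing `g' = -c` removes this term (`exists_conj_step`).
The products converge because the `n`-th factor changes only orders at most `-n`. Raising the
relation between the roots to the power `m = ord L` gives the conjugacy of `L` and `M`. -/

namespace LaurentSeries

open scoped LaurentSeries

variable {k : Type*} [Field k]

/-! ### Derivatives and residues of Laurent series -/

theorem coeff_ddx (f : k⸨X⸩) (n : ℤ) :
    (ddx k f).coeff n = ((n + 1 : ℤ) : k) * f.coeff (n + 1) := by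
  change (derivative k f).coeff n = _
  rw [derivative_apply, hasseDeriv_coeff, Nat.cast_one, Ring.choose_one_right', zsmul_eq_mul]
  simp

theorem coeff_neg_one_ddx (f : k⸨X⸩) : (ddx k f).coeff (-1) = 0 := by
  simp [coeff_ddx]

/-- Integrate term by term: in characteristic 0 the only obstruction is the `x⁻¹` term, which would
need a logarithm. -/
theorem exists_ddx_eq [CharZero k] {f : k⸨X⸩} (hf : f.coeff (-1) = 0) : ∃ g, ddx k g = f := by
  refine ⟨HahnSeries.ofSuppBddBelow (fun n => f.coeff (n - 1) / n) ⟨f.order, fun n hn => ?_⟩, ?_⟩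
  · contrapose! hn
    rw [Function.notMem_support, HahnSeries.coeff_eq_zero_of_lt_order (by omega), zero_div]
  · ext n
    rw [coeff_ddx]
    change ((n + 1 : ℤ) : k) * (f.coeff (n + 1 - 1) / ((n + 1 : ℤ) : k)) = f.coeff n
    rw [add_sub_cancel_right]
    -- At `n = -1` the primitive's constant term was formed by dividing by zero; differentiation
    -- discards it, and `hf` supplies the required value 0.
    rcases eq_or_ne n (-1) with rfl | hn
    · simp [hf]
    · have : ((n + 1 : ℤ) : k) ≠ 0 := Int.cast_ne_zero.2 (by omega)
      field_simp

theorem ddx_mul (f g : k⸨X⸩) : ddx k (f * g) = f * ddx k g + ddx k f * g :=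
  derivative_leibniz f g

/-- Iterated integration by parts for the residue. -/
theorem coeff_neg_one_mul_iterate_ddx (w : ℕ) (a b : k⸨X⸩) :
    (a * (ddx k)^[w] b).coeff (-1) = (-1) ^ w * ((ddx k)^[w] a * b).coeff (-1) := by
  induction w generalizing a b with
  | zero => simp
  | succ w ih =>
    -- A total derivative has no residue; this moves the one derivative left on `b` over to the
    -- other factor.
    have h := coeff_neg_one_ddx ((ddx k)^[w] a * b)
    rw [ddx_mul, HahnSeries.coeff_add, ← Function.iterate_succ_apply' (ddx k)] at h
    rw [Function.iterate_succ_apply, ih, pow_succ,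
      eq_neg_of_add_eq_zero_left h]
    ring

end LaurentSeries

/-! ### The residue as a trace -/

namespace LaurentPDO

open PseudoDiffOp

variable {k : Type*} [Field k]

@[simp] theorem res_zero : res (0 : LaurentPDO k) = 0 := rfl

@[simp] theorem res_add (A B : LaurentPDO k) : res (A + B) = res A + res B := rfl

@[simp] theorem res_neg (A : LaurentPDO k) : res (-A) = -res A := rfl

theorem res_eq_zero_of_mem {A : LaurentPDO k} (hA : A ∈ ordLT k (-1)) : res A = 0 := by
  rw [res, hA _ le_rfl, HahnSeries.coeff_zero]

/-- With `w = i + j + 1`, the two residues are those of `a b^(w)` and `b a^(w)`, weighted by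
binomials. Integration by parts and reflection of the binomial each contribute `(-1) ^ w`, and the
signs cancel. -/
theorem res_mono_mul_mono_comm (a b : LaurentSeries k) (i j : ℤ) :
    res (mono (LaurentSeries.ddx k) a i * mono _ b j) = res (mono _ b j * mono _ a i) := by
  rcases lt_or_ge (i + j) (-1) with h | h
  · rw [res_eq_zero_of_mem (ordLT_mono (by omega) (mul_mem_ordLT (mono_mem a i) (mono_mem b j))),
      res_eq_zero_of_mem (ordLT_mono (by omega) (mul_mem_ordLT (mono_mem b j) (mono_mem a i)))]
  obtain ⟨w, hw⟩ : ∃ w : ℕ, -1 + (w : ℤ) = i + j := ⟨(i + j + 1).toNat, by omega⟩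
  -- Upper negation of the binomial, using `i = w - 1 - j`.
  have hc : Ring.choose j w = (-1) ^ w * Ring.choose i w := by
    have h := Ring.choose_neg (-j) w
    rw [neg_neg, Units.smul_def, show -j + w - 1 = i by omega] at h
    simpa [Int.negOnePow] using h
  rw [res, res, coeff_mono_mul_mono _ _ _ _ _ hw,
    coeff_mono_mul_mono _ _ _ _ _ (by rw [hw, add_comm]), hc,
    HahnSeries.coeff_smul, HahnSeries.coeff_smul,
    LaurentSeries.coeff_neg_one_mul_iterate_ddx, mul_comm b, zsmul_eq_mul, zsmul_eq_mul]
  push_cast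
  ring

/-- The residue ignores orders below `-1`, so both factors may be cut off to finite sums of
monomials, and additivity reduces the claim to the monomial case. -/
theorem res_mul_comm (A B : LaurentPDO k) : res (A * B) = res (B * A) := by
  obtain ⟨a, ha⟩ := A.bdd
  obtain ⟨b, hb⟩ := B.bdd
  -- The cutoffs `-b` and `-a` push every error product below order `-1`; the minimum with `a` keeps
  -- the order bound of `A` valid for `A'`.
  obtain ⟨A', hA', hA⟩ := exists_trunc A (min a (-b))
  obtain ⟨B', hB', hB⟩ := exists_trunc B (-a)
  have ha' : A' ∈ ordLT k a := by
    simpa using (ordLT k a).sub_mem ha (ordLT_mono (min_le_left _ _) hA)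
  have e1 : A * B = A' * B' + ((A - A') * B + A' * (B - B')) := by
    simp only [sub_mul, mul_sub]; abel
  have e2 : B * A = B' * A' + (B * (A - A') + (B - B') * A') := by
    simp only [sub_mul, mul_sub]; abel
  have main : res (A' * B') = res (B' * A') := by
    clear e1 e2 hA hB ha'
    induction hA' using AddSubgroup.closure_induction with
    | zero => simp
    | add x y _ _ hx hy => simp [add_mul, mul_add, hx, hy]
    | neg x _ hx => simp [hx]
    | mem x hx =>
      obtain ⟨⟨f, i⟩, rfl⟩ := hx
      induction hB' using AddSubgroup.closure_induction with
      | zero => simp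
      | add x y _ _ hx hy => simp [add_mul, mul_add, hx, hy]
      | neg x _ hx => simp [hx]
      | mem x hx =>
        obtain ⟨⟨g, j⟩, rfl⟩ := hx
        exact res_mono_mul_mono_comm f g i j
  rw [e1, e2, res_add (A' * B'), res_add (B' * A'), main,
    res_eq_zero_of_mem (add_mem (ordLT_mono (by omega) (mul_mem_ordLT hA hb))
      (ordLT_mono (by omega) (mul_mem_ordLT ha' hB))),
    res_eq_zero_of_mem (add_mem (ordLT_mono (by omega) (mul_mem_ordLT hb hA))
      (ordLT_mono (by omega) (mul_mem_ordLT hB ha')))]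

theorem res_conj {S : LaurentPDO k} (hS : S ≠ 0) (A : LaurentPDO k) :
    res (S⁻¹ * A * S) = res A := by
  rw [res_mul_comm, ← mul_assoc, mul_inv_cancel₀ hS, one_mul]

end LaurentPDO

/-! ### Conjugation, commutators and roots -/

namespace PseudoDiffOp

variable {K : Type*} [Field K] {δ : Derivation ℤ K K}

theorem isMonic_zpow_D (m : ℤ) : IsMonic (D δ ^ m) m := by
  obtain ⟨n, rfl | rfl⟩ := m.eq_nat_or_neg
  · rw [zpow_natCast]
    exact isMonic_D.pow n
  · rw [zpow_neg, zpow_natCast]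
    exact (isMonic_D.pow n).inv

theorem IsMonic.of_sub_mem {L M : PseudoDiffOp δ} {m : ℤ} (hM : IsMonic M m)
    (h : L - M ∈ ordLT δ m) : IsMonic L m := by
  rw [← sub_add_cancel L M]
  exact ⟨add_mem (ordLT_mono (by omega) h) hM.1, by
    rw [coeff_add, h m le_rfl, hM.2, zero_add]⟩

theorem IsMonic.ne_zero {L : PseudoDiffOp δ} {m : ℤ} (hL : IsMonic L m) : L ≠ 0 := by
  rintro rfl
  exact zero_ne_one hL.2

theorem isMonic_zero_of_sub_one_mem {S : PseudoDiffOp δ} (hS : S - 1 ∈ ordLT δ 0) :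
    IsMonic S 0 :=
  isMonic_one.of_sub_mem hS

/-- `S` intertwines the conjugate with `R`, and an intertwining relation passes to all integer
powers, negative ones included. -/
theorem conj_zpow {S : PseudoDiffOp δ} (hS : S ≠ 0) (R : PseudoDiffOp δ) (j : ℤ) :
    (S⁻¹ * R * S) ^ j = S⁻¹ * R ^ j * S := by
  have h : SemiconjBy S (S⁻¹ * R * S) R := by
    rw [SemiconjBy, mul_assoc, ← mul_assoc, mul_inv_cancel₀ hS, one_mul]
  have := h.zpow_right₀ j
  rw [mul_assoc _ (R ^ j), ← this.eq, ← mul_assoc, inv_mul_cancel₀ hS, one_mul]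

theorem IsMonic.conj {S R : PseudoDiffOp δ} {m : ℤ} (hS : IsMonic S 0) (hR : IsMonic R m) :
    IsMonic (S⁻¹ * R * S) m := by
  simpa using (hS.inv.mul hR).mul hS

/-- Conjugation commutes with the extraction of roots. -/
theorem root_conj [CharZero K] {L S : PseudoDiffOp δ} {m : ℤ} (hm : m ≠ 0) (hL : IsMonic L m)
    (hS : IsMonic S 0) : (S⁻¹ * L * S).root = S⁻¹ * L.root * S := by
  have hc := hS.conj hL
  refine (existsUnique_root hm hc).unique (root_spec hm hc) ⟨hS.conj (root_spec hm hL).1, ?_⟩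
  rw [conj_zpow hS.ne_zero, hc.ord_eq, ← hL.ord_eq, (root_spec hm hL).2]

/-- Write `R = ∂ + E` with `E` of order at most 0. Leading coefficients commute, so `E` contributes
only below order `n`; the commutator with `∂` supplies the derivative of `g`. -/
theorem commutator_mono {R : PseudoDiffOp δ} (hR : IsMonic R 1) (g : K) (n : ℤ) :
    R * mono δ g n - mono δ g n * R - mono δ (δ g) n ∈ ordLT δ n := by
  have hE : R - D δ ∈ ordLT δ (0 + 1) := fun i hi => by
    rcases eq_or_ne i 1 with rfl | h
    · rw [coeff_sub, hR.2, isMonic_D.2, sub_self]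
    · rw [coeff_sub, hR.1 i (by omega), isMonic_D.1 i (by omega), sub_self]
  have h1 : (R - D δ) * mono δ g n - mono δ g n * (R - D δ) ∈ ordLT δ n := fun i hi => by
    rcases hi.eq_or_lt with rfl | h
    · have t1 := coeff_mul_top hE (mono_mem (d := δ) g n)
      have t2 := coeff_mul_top (mono_mem (d := δ) g n) hE
      rw [zero_add] at t1
      rw [add_zero] at t2
      rw [coeff_sub, t1, t2, mul_comm, sub_self]
    · rw [coeff_sub, mul_mem_ordLT hE (mono_mem g n) i (by omega),
        mul_mem_ordLT (mono_mem g n) hE i (by omega), sub_zero]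
  have h2 : D δ * mono δ g n - mono δ g n * D δ - mono δ (δ g) n ∈ ordLT δ n := fun i hi => by
    -- At order `n + 1` the leading terms of the two products cancel; at order `n` the Leibniz rule
    -- leaves `δ g`.
    rcases lt_trichotomy i (n + 1) with h | rfl | h
    · obtain rfl : i = n := by omega
      rw [coeff_sub, coeff_sub, D, coeff_mono_mul_mono _ _ _ _ _ (w := 1) (by push_cast; ring),
        coeff_mono_mul_mono _ _ _ _ _ (w := 1) (by push_cast; ring), coeff_mono, if_pos rfl,
        Ring.choose_one_right]
      simp
    · rw [coeff_sub, coeff_sub, D, coeff_mono_mul_mono _ _ _ _ _ (w := 0) (by push_cast; ring),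
        coeff_mono_mul_mono _ _ _ _ _ (w := 0) (by push_cast; ring), coeff_mono,
        if_neg (by omega)]
      simp
    · rw [coeff_sub, coeff_sub, mul_mem_ordLT isMonic_D.1 (mono_mem g n) i (by omega),
        mul_mem_ordLT (mono_mem g n) isMonic_D.1 i (by omega), mono_mem _ _ i (by omega)]
      simp
  have e : R * mono δ g n - mono δ g n * R - mono δ (δ g) n =
      ((R - D δ) * mono δ g n - mono δ g n * (R - D δ)) +
        (D δ * mono δ g n - mono δ g n * D δ - mono δ (δ g) n) := by
    simp only [sub_mul, mul_sub]; abel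
  rw [e]
  exact add_mem h1 h2

/-- The resolvent identity: agreement to a given depth below the leading term survives inversion. It
reduces negative exponents to positive ones. -/
theorem inv_sub_inv_mem {L M : PseudoDiffOp δ} {m a : ℤ} (hL : IsMonic L m) (hM : IsMonic M m)
    (h : L - M ∈ ordLT δ (m + a)) : L⁻¹ - M⁻¹ ∈ ordLT δ (-m + a) := by
  have e : L⁻¹ - M⁻¹ = -(L⁻¹ * (L - M) * M⁻¹) := by
    rw [mul_sub, inv_mul_cancel₀ hL.ne_zero, sub_mul, mul_assoc, mul_inv_cancel₀ hM.ne_zero]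
    simp
  rw [e]
  exact neg_mem (ordLT_mono (by omega) (mul_mem_ordLT (mul_mem_ordLT hL.inv.1 h) hM.inv.1))

/-- The coefficient of `∂ ^ (n - 1)` in `R ^ n - T ^ n` is `n` times the order-0 coefficient of `R -
T`. -/
theorem sub_mem_ordLT_zero_of_pow [CharZero K] {R T : PseudoDiffOp δ} (hR : IsMonic R 1)
    (hT : IsMonic T 1) {n : ℕ} (hn : n ≠ 0) (h : R ^ n - T ^ n ∈ ordLT δ (n - 1)) :
    R - T ∈ ordLT δ 0 := by
  have hE : R - T ∈ ordLT δ (0 + 1) := fun i hi => by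
    rcases eq_or_ne i 1 with rfl | h
    · rw [coeff_sub, hR.2, hT.2, sub_self]
    · rw [coeff_sub, hR.1 i (by omega), hT.1 i (by omega), sub_self]
  have h1 := (add_pow_sub_pow hT le_rfl hE n).2
  rw [add_sub_cancel, h _ (by omega)] at h1
  intro i hi
  rcases hi.eq_or_lt with rfl | hlt
  · exact (mul_eq_zero.1 h1.symm).resolve_left (Nat.cast_ne_zero.2 hn)
  · exact hE i (by omega)

theorem sub_mem_ordLT_zero_of_zpow [CharZero K] {R T : PseudoDiffOp δ} (hR : IsMonic R 1)
    (hT : IsMonic T 1) {m : ℤ} (hm : m ≠ 0) (h : R ^ m - T ^ m ∈ ordLT δ (m - 1)) :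
    R - T ∈ ordLT δ 0 := by
  obtain ⟨n, rfl | rfl⟩ := m.eq_nat_or_neg
  · rw [zpow_natCast, zpow_natCast] at h
    exact sub_mem_ordLT_zero_of_pow hR hT (by omega) h
  · rw [zpow_neg, zpow_neg, zpow_natCast, zpow_natCast] at h
    refine sub_mem_ordLT_zero_of_pow hR hT (n := n) (by omega) ?_
    have := inv_sub_inv_mem (hR.pow n).inv (hT.pow n).inv h
    simpa [sub_eq_add_neg] using this

end PseudoDiffOp

/-! ### Construction of the conjugating operator -/

namespace LaurentPDO

open PseudoDiffOp

variable {k : Type*} [Field k]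

@[simp] theorem res_sub (A B : LaurentPDO k) : res (A - B) = res A - res B := rfl

/-- One step of the successive approximation of a conjugating operator: the error of `S` in the
equation `R S = S T` is improved by one order. -/
theorem exists_conj_step [CharZero k] {R T S : LaurentPDO k} (hR : IsMonic R 1)
    (hT : IsMonic T 1) (hS : IsMonic S 0) {n : ℕ} (hn : n ≠ 0) (hres : res (R ^ n) = res (T ^ n))
    (h : R * S - S * T ∈ ordLT k (1 - n)) :
    ∃ g, R * (S * (1 + mono _ g (-n))) - S * (1 + mono _ g (-n)) * T ∈ ordLT k (-n) := by
  have hR' := hS.conj hR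
  have hS0 := hS.ne_zero
  obtain ⟨R', hR'd⟩ : ∃ R', R' = S⁻¹ * R * S := ⟨_, rfl⟩
  rw [← hR'd] at hR'
  have hRS : R * S = S * R' := by
    rw [hR'd, ← mul_assoc, ← mul_assoc, mul_inv_cancel₀ hS0, one_mul]
  have hE : R' - T ∈ ordLT k (-n + 1) := by
    have e : R' - T = S⁻¹ * (R * S - S * T) := by
      rw [hRS, ← mul_sub, ← mul_assoc, inv_mul_cancel₀ hS0, one_mul]
    rw [e]
    exact ordLT_mono (by omega) (mul_mem_ordLT hS.inv.1 h)
  -- The exponent `n` is the one for which the leading error, at order `-n`, shows up at order `-1`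
  -- of the `n`-th power, multiplied by `n`.
  have hr : ((R' - T).coeff (-n)).coeff (-1) = 0 := by
    have h1 := (add_pow_sub_pow hT (by omega) hE n).2
    have h2 : res (R' ^ n) = res (R ^ n) := by
      have := res_conj hS0 (R ^ n)
      rwa [← zpow_natCast, ← conj_zpow hS0, ← hR'd, zpow_natCast] at this
    have h3 : res (R' ^ n - T ^ n) = 0 := by rw [res_sub, h2, hres, sub_self]
    rw [add_sub_cancel, neg_add_cancel, zero_sub] at h1
    rw [res, h1, ← nsmul_eq_mul, HahnSeries.coeff_smul, nsmul_eq_mul] at h3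
    exact (mul_eq_zero.1 h3).resolve_left (Nat.cast_ne_zero.2 hn)
  obtain ⟨f, hf⟩ := LaurentSeries.exists_ddx_eq hr
  -- The sign makes the commutator term `-f' ∂ ^ (-n)` cancel the leading error `f' ∂ ^ (-n)`.
  refine ⟨-f, ?_⟩
  obtain ⟨G, hG⟩ : ∃ G, G = mono (LaurentSeries.ddx k) (-f) (-n) := ⟨_, rfl⟩
  have hGm : G ∈ ordLT k (-n + 1) := hG ▸ mono_mem _ _
  have hcomm := commutator_mono hR' (-f) (-n)
  rw [← hG] at hcomm ⊢
  have e : R * (S * (1 + G)) - S * (1 + G) * T =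
      S * (((R' * G - G * R') - mono _ (LaurentSeries.ddx k (-f)) (-n)) +
        ((R' - T) + mono _ (LaurentSeries.ddx k (-f)) (-n)) + G * (R' - T)) := by
    rw [← mul_assoc, hRS, mul_assoc, mul_assoc, ← mul_sub]
    congr 1
    simp only [mul_add, add_mul, mul_sub, one_mul, mul_one]
    abel
  have hmid : (R' - T) + mono _ (LaurentSeries.ddx k (-f)) (-n) ∈ ordLT k (-n) := fun i hi => by
    rcases hi.eq_or_lt with rfl | hlt
    · rw [coeff_add, coeff_mono, if_pos rfl, map_neg, hf, add_neg_cancel]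
    · rw [coeff_add, hE i (by omega), coeff_mono, if_neg (by omega), add_zero]
  rw [e]
  -- The quadratic term `G * (R' - T)` has order at most `-2 n`, which is below `-n` because `n` is
  -- positive.
  refine ordLT_mono (by omega) (mul_mem_ordLT hS.1 (add_mem (add_mem hcomm hmid)
    (ordLT_mono ?_ (mul_mem_ordLT hGm hE))))
  omega

/-- Working with `R S = S T` instead of the conjugate makes the error additive in `S`, so it passes
to the limit without inverting the approximations. -/
theorem exists_conj_of_res_pow_eq [CharZero k] {R T : LaurentPDO k} (hR : IsMonic R 1)
    (hT : IsMonic T 1) (h0 : R - T ∈ ordLT k 0) (hres : ∀ n : ℕ, res (R ^ n) = res (T ^ n)) :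
    ∃ S : LaurentPDO k, S - 1 ∈ ordLT k 0 ∧ T = S⁻¹ * R * S := by
  have hstep : ∀ (j : ℕ) (S : LaurentPDO k), ∃ g, IsMonic S 0 → R * S - S * T ∈ ordLT k (-j) →
      R * (S * (1 + mono _ g (-(j + 1)))) - S * (1 + mono _ g (-(j + 1))) * T ∈
        ordLT k (-(j + 1)) := by
    intro j S
    by_cases hS : IsMonic S 0 ∧ R * S - S * T ∈ ordLT k (-j)
    · obtain ⟨g, hg⟩ := exists_conj_step hR hT hS.1 j.succ_ne_zero (hres _)
        (by simpa using hS.2)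
      exact ⟨g, fun _ _ => by simpa [add_comm] using hg⟩
    -- A junk value: `g` must be defined for every `S`, since the recursion for `F` precedes the
    -- proof of its invariants.
    · exact ⟨0, fun h1 h2 => absurd ⟨h1, h2⟩ hS⟩
  choose g hg using hstep
  let F : ℕ → LaurentPDO k := fun j =>
    Nat.rec 1 (fun j S => S * (1 + mono _ (g j S) (-((j : ℤ) + 1)))) j
  have hF : ∀ j, F (j + 1) = F j * (1 + mono _ (g j (F j)) (-((j : ℤ) + 1))) := fun _ => rfl
  have hmono : ∀ j : ℕ, IsMonic (1 + mono (LaurentSeries.ddx k) (g j (F j)) (-((j : ℤ) + 1))) 0 :=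
    fun j => isMonic_zero_of_sub_one_mem (by
      rw [add_sub_cancel_left]
      exact ordLT_mono (by omega) (mono_mem _ _))
  have key : ∀ j : ℕ, IsMonic (F j) 0 ∧ R * F j - F j * T ∈ ordLT k (-j) := by
    intro j
    induction j with
    | zero =>
      refine ⟨isMonic_one, ?_⟩
      change R * 1 - 1 * T ∈ _
      simpa using h0
    | succ j ih =>
      rw [hF]
      exact ⟨by simpa using ih.1.mul (hmono j), by simpa using hg j (F j) ih.1 ih.2⟩
  have hdiff : ∀ j : ℕ, F (j + 1) - F j ∈ ordLT k (-j) := fun j => by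
    rw [hF, mul_add, mul_one, add_sub_cancel_left]
    exact ordLT_mono (by omega) (mul_mem_ordLT (key j).1.1 (mono_mem _ _))
  obtain ⟨S, hS⟩ := exists_limit F fun j => ordLT_mono (by omega) (hdiff j)
  have hS1 : S - 1 ∈ ordLT k 0 := by
    -- The limit bound at index 0 only gives order below 1, so the comparison with `F 0 = 1` goes
    -- through `F 1`.
    rw [← sub_add_sub_cancel S (F 1)]
    have h : F 1 - F 0 ∈ ordLT k 0 := by simpa using hdiff 0
    exact add_mem (by simpa using hS 1) h
  refine ⟨S, hS1, ?_⟩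
  have hRS : R * S - S * T = 0 := eq_zero_of_forall_mem (c := 2) fun j => by
    have e : R * S - S * T = (R * F j - F j * T) + (R * (S - F j) - (S - F j) * T) := by
      simp only [sub_mul, mul_sub]; abel
    rw [e]
    exact add_mem (ordLT_mono (by omega) (key j).2)
      (sub_mem (ordLT_mono (by omega) (mul_mem_ordLT hR.1 (hS j)))
        (ordLT_mono (by omega) (mul_mem_ordLT (hS j) hT.1)))
  rw [mul_assoc, sub_eq_zero.1 hRS, ← mul_assoc,
    inv_mul_cancel₀ (isMonic_zero_of_sub_one_mem hS1).ne_zero, one_mul]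

theorem isMonic_of_sub_zpow_D_mem {L : LaurentPDO k} {m : ℤ}
    (h : L - D k ^ m ∈ ordLT k (m - 1)) : IsMonic L m :=
  (isMonic_zpow_D m).of_sub_mem (ordLT_mono (by omega) h)

end LaurentPDO

/-! ### The equivalence -/

theorem theorem2 (k : Type*) [Field k] [CharZero k] (L M : LaurentPDO k)
    (hL0 : L.ord ≠ 0) (hM0 : M.ord ≠ 0)
    (hL : ∃ m : ℤ, L - LaurentPDO.D k ^ m ∈ LaurentPDO.ordLT k (m - 1))
    (hM : ∃ m : ℤ, M - LaurentPDO.D k ^ m ∈ LaurentPDO.ordLT k (m - 1)) :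
    (∃ S : LaurentPDO k, S - 1 ∈ LaurentPDO.ordLT k 0 ∧ M = S⁻¹ * L * S) ↔
      (L.ord = M.ord ∧
        ∀ q : ℚ, (∃ j : ℤ, q = (j : ℚ) / (L.ord : ℚ)) →
          LaurentPDO.res (L.ratPow q) = LaurentPDO.res (M.ratPow q)) := by
  have : CharZero (LaurentSeries k) :=
    charZero_of_injective_ringHom (HahnSeries.C_injective (Γ := ℤ) (R := k))
  obtain ⟨m, hL⟩ := hL
  obtain ⟨m', hM⟩ := hM
  have hLm := LaurentPDO.isMonic_of_sub_zpow_D_mem hL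
  have hMm := LaurentPDO.isMonic_of_sub_zpow_D_mem hM
  have hLo := hLm.ord_eq
  have hMo := hMm.ord_eq
  have hm : m ≠ 0 := hLo ▸ hL0
  have hm' : m' ≠ 0 := hMo ▸ hM0
  constructor
  · rintro ⟨S, hS, rfl⟩
    have hS0 := PseudoDiffOp.isMonic_zero_of_sub_one_mem hS
    have ho := (hS0.conj hLm).ord_eq
    refine ⟨by rw [ho, hLo], fun q _ => ?_⟩
    rw [PseudoDiffOp.ratPow, PseudoDiffOp.ratPow, PseudoDiffOp.root_conj hm hLm hS0, ho, hLo,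
      PseudoDiffOp.conj_zpow hS0.ne_zero, LaurentPDO.res_conj hS0.ne_zero]
  · rintro ⟨ho, hres⟩
    obtain rfl : m = m' := by omega
    obtain ⟨hR, hRL⟩ := PseudoDiffOp.root_spec hm hLm
    obtain ⟨hT, hTM⟩ := PseudoDiffOp.root_spec hm hMm
    rw [hLo] at hRL hres
    rw [hMo] at hTM
    -- The normalization enters here: both coefficients of `∂ ^ (m - 1)` vanish, so `L - M` has
    -- order below `m - 1`.
    have h0 : L.root - M.root ∈ LaurentPDO.ordLT k 0 := by
      refine PseudoDiffOp.sub_mem_ordLT_zero_of_zpow hR hT hm ?_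
      rw [hRL, hTM, ← sub_sub_sub_cancel_right _ _ (LaurentPDO.D k ^ m)]
      exact sub_mem hL hM
    obtain ⟨S, hS, hST⟩ := LaurentPDO.exists_conj_of_res_pow_eq hR hT h0 fun n => by
      -- Only the nonnegative powers of the roots are needed, whatever the sign of `m`.
      have h := hres (((n : ℤ) : ℚ) / m) ⟨n, rfl⟩
      rw [PseudoDiffOp.ratPow, PseudoDiffOp.ratPow, hLo, hMo,
        div_mul_cancel₀ _ (Int.cast_ne_zero.2 hm), Rat.num_intCast, zpow_natCast,
        zpow_natCast] at h
      exact h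
    refine ⟨S, hS, ?_⟩
    rw [← hTM, hST, PseudoDiffOp.conj_zpow (PseudoDiffOp.isMonic_zero_of_sub_one_mem hS).ne_zero,
      hRL]
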